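/- **Setting.** Let $A,E\in\mathbb C^{n\times n}$, $B\in\mathbb C^{n\times m}$, $C\in\mathbb C^{p\times n}$, $D\in\mathbb C^{p\times m}$ with $m,p\le n$, and $H(s)=C(sE-A)^{-1}B+D$. Assume that the pencil $L(s)=A-sE$ is regular, that its finite eigenvalues (the poles of the system) are simple and, if $E$ is singular, that $0$ is a semisimple eigenvalue of $E-sA$. For a finite eigenvalue $\lambda$ with right and left eigenvectors $v,w$ scaled so that $w^*Ev=1$, the dominance metric is $\|Cv\|_2\|w^*B\|_2/|\mathrm{Re}\,\lambda|$; a dominant pole is a finite eigenvalue with maximal dominance metric. For $V,W\in\mathbb C^{n\times k}$ with orthonormal columns, the reduced system has the matrices $W^*AV,\ W^*EV,\ W^*B,\ CV,\ D$; its poles are the finite eigenvalues of $W^*AV-sW^*EV$. **Subspace framework (one dominant pole sought).** Fix an integer $q$ with $q\ge1$ if $m=p$ and $q\ge2$ if $m\ne p$. Let $P_R(\mu)=I_m$ if $m\le p$ and $P_R(\mu)=H(\mu)^*$ if $m>p$; let $P_L(\mu)=I_p$ if $p\le m$ and $P_L(\mu)=H(\mu)$ if $p>m$. Start with matrices $V_0,W_0$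 with orthonormal columns and the same number of columns. For $\ell=1,2,\dots$, let $\mu_\ell$ be a dominant pole of the system reduced by $V_{\ell-1},W_{\ell-1}$; unless the method terminates, choose $V_\ell$ and $W_\ell$ (with equally many columns) so that their columns form orthonormal bases of the column spaces of $$\big[\,V_{\ell-1}\ \ \widehat V_0\ \cdots\ \widehat V_q\,\big],\quad \widehat V_r=\{(A-\mu_\ell E)^{-1}E\}^r(A-\mu_\ell E)^{-1}B\,P_R(\mu_\ell),$$ $$\big[\,W_{\ell-1}\ \ \widehat W_0\ \cdots\ \widehat W_q\,\big],\quad \widehat W_r=\{(A-\mu_\ell E)^{-*}E^*\}^r(A-\mu_\ell E)^{-*}C^*P_L(\mu_\ell),$$ where $A-\mu_\ell E$ has to be invertible. **Theorem (at least quadratic convergence).** Let $\lambda_1$ be a dominant pole of the full system with $C\,\mathrm{adj}(\lambda_1E-A)\,B\ne0$, and suppose that the Hessian at $\lambda_1$, with respect to $(\mathrm{Re}\,s,\mathrm{Im}\,s)$, of $$f(s)=\frac{|\det(sE-A)|^2}{\|C\,\mathrm{adj}(sE-A)\,B\|_F^2}$$ is invertible. Let $\beta>0$. Then there are constants $\delta>0$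 and $K>0$, depending only on $A,E,B,C,D,\lambda_1,\beta$, such that for every admissible $q$, every run of the framework and every $j\ge1$ for which $\mu_j,\mu_{j+1}$ are computed: if 1. $\mu_j$ is neither an eigenvalue of $L$ nor a pole of the system reduced by $V_j,W_j$, 2. $\|CV_j\,\mathrm{adj}(\mu_{j+1}W_j^*EV_j-W_j^*AV_j)\,W_j^*B\|_2\ge\beta$, 3. $|\mu_j-\lambda_1|\le\delta$ and $|\mu_{j+1}-\lambda_1|\le\delta$, then $$|\lambda_1-\mu_{j+1}|\le K\,|\lambda_1-\mu_j|^2 .$$ -/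

import Mathlib

open Matrix Polynomial

/-- The matrices of `E x' = A x + B u`, `y = C x + D u`, with `n` states, `m` inputs and
`p` outputs. -/
structure DescriptorSystem (n m p : ℕ) where
  A : Matrix (Fin n) (Fin n) ℂ
  E : Matrix (Fin n) (Fin n) ℂ
  B : Matrix (Fin n) (Fin m) ℂ
  C : Matrix (Fin p) (Fin n) ℂ
  D : Matrix (Fin p) (Fin m) ℂ

namespace DescriptorSystem

noncomputable section

variable {n m p : ℕ}

/-- The polynomial `det (A - X E)`. -/
def charPencil (S : DescriptorSystem n m p) : ℂ[X] :=
  (S.A.map Polynomial.C - (X : ℂ[X]) • S.E.map Polynomial.C).det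

/-- The polynomial `det (E - X A)`. -/
def charPencilRev (S : DescriptorSystem n m p) : ℂ[X] :=
  (S.E.map Polynomial.C - (X : ℂ[X]) • S.A.map Polynomial.C).det

/-- `l` is a finite eigenvalue of the pencil `A - s E`, that is, a pole of the system. -/
def IsPole (S : DescriptorSystem n m p) (l : ℂ) : Prop :=
  (S.A - l • S.E).det = 0

/-- `l` is a simple finite eigenvalue of the pencil `A - s E`. -/
def IsSimplePole (S : DescriptorSystem n m p) (l : ℂ) : Prop :=
  S.charPencil.rootMultiplicity l = 1

/-- The standing assumptions on the full system: `n ≥ m`, `n ≥ p`, the pencil `A - s E` is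
regular, its finite eigenvalues are simple, and, if `E` is singular, the index is one, i.e. the
eigenvalue `0` of `E - s A` has equal algebraic and geometric multiplicities. -/
structure Standing (S : DescriptorSystem n m p) : Prop where
  inputs_le : m ≤ n
  outputs_le : p ≤ n
  regular : ∃ s : ℂ, (S.A - s • S.E).det ≠ 0
  simple : ∀ l : ℂ, S.IsPole l → S.IsSimplePole l
  index_one : S.E.det = 0 →
    S.charPencilRev.rootMultiplicity 0 = Module.finrank ℂ (LinearMap.ker S.E.mulVecLin)

/-- The transfer function `H(s) = C (s E - A)⁻¹ B + D`. -/
def transfer (S : DescriptorSystem n m p) (s : ℂ) : Matrix (Fin p) (Fin m) ℂ :=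
  S.C * (s • S.E - S.A)⁻¹ * S.B + S.D

/-- `v` and `w` are right and left eigenvectors of `A - s E` for the eigenvalue `l`, scaled so
that `w* E v = 1` (in particular they are nonzero). -/
def IsEigenTriple (S : DescriptorSystem n m p) (l : ℂ) (v w : Fin n → ℂ) : Prop :=
  (S.A - l • S.E) *ᵥ v = 0 ∧ star w ᵥ* (S.A - l • S.E) = 0 ∧ star w ⬝ᵥ (S.E *ᵥ v) = 1

open scoped ENNReal in
/-- The dominance metric `‖C v‖₂ ‖w* B‖₂ / |Re l|` (infinite if only the denominator is zero). -/
def dominance (S : DescriptorSystem n m p) (l : ℂ) (v w : Fin n → ℂ) : ℝ≥0∞ :=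
  ‖WithLp.toLp 2 (S.C *ᵥ v)‖ₑ * ‖WithLp.toLp 2 (star w ᵥ* S.B)‖ₑ / ‖l.re‖ₑ

/-- `l` is a dominant pole: a finite eigenvalue with largest dominance metric. At a simple
eigenvalue the metric does not depend on the choice of the scaled eigenvectors, so if all finite
eigenvalues are simple this is the usual definition. The pencils of reduced systems are
not assumed to have simple eigenvalues only; there, any scaled eigenvectors of `l` may be used, and
the comparison is with the simple eigenvalues. -/
def IsDominantPole (S : DescriptorSystem n m p) (l : ℂ) : Prop :=
  ∃ v w, S.IsEigenTriple l v w ∧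
    ∀ l' v' w', S.IsSimplePole l' → S.IsEigenTriple l' v' w' →
      S.dominance l' v' w' ≤ S.dominance l v w

/-- The reduced system obtained by the Petrov-Galerkin projection with `V` and `W`. -/
def reduce (S : DescriptorSystem n m p) {k : ℕ} (V W : Matrix (Fin n) (Fin k) ℂ) :
    DescriptorSystem k m p where
  A := Wᴴ * S.A * V
  E := Wᴴ * S.E * V
  B := Wᴴ * S.B
  C := S.C * V
  D := S.D

/-- `C adj(s E - A) B`. -/
def adjTransfer (S : DescriptorSystem n m p) (s : ℂ) : Matrix (Fin p) (Fin m) ℂ :=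
  S.C * (s • S.E - S.A).adjugate * S.B

/-- `f(s) = |det (s E - A)|² / ‖C adj(s E - A) B‖_F²`. -/
def f (S : DescriptorSystem n m p) (s : ℂ) : ℝ :=
  ‖(s • S.E - S.A).det‖ ^ 2 / ∑ i, ∑ j, ‖S.adjTransfer s i j‖ ^ 2

/-- `P_R(s)`, with `min m p` columns: `I_m` if `m ≤ p`, and `H(s)*` if `m > p`. -/
def PR (S : DescriptorSystem n m p) (s : ℂ) : Matrix (Fin m) (Fin (min m p)) ℂ :=
  if m ≤ p then (1 : Matrix (Fin m) (Fin m) ℂ).submatrix id (Fin.castLE (min_le_left m p))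
  else (S.transfer s)ᴴ.submatrix id (Fin.castLE (min_le_right m p))

/-- `P_L(s)`, with `min m p` columns: `I_p` if `p ≤ m`, and `H(s)` if `p > m`. -/
def PL (S : DescriptorSystem n m p) (s : ℂ) : Matrix (Fin p) (Fin (min m p)) ℂ :=
  if p ≤ m then (1 : Matrix (Fin p) (Fin p) ℂ).submatrix id (Fin.castLE (min_le_right m p))
  else (S.transfer s).submatrix id (Fin.castLE (min_le_left m p))

/-- The successive values of `V̂` in the expansion at the point `s`. -/
def hatV (S : DescriptorSystem n m p) (s : ℂ) : ℕ → Matrix (Fin n) (Fin (min m p)) ℂ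
  | 0 => (S.A - s • S.E)⁻¹ * S.B * S.PR s
  | r + 1 => (S.A - s • S.E)⁻¹ * S.E * hatV S s r

/-- The successive values of `Ŵ` in the expansion at the point `s`. -/
def hatW (S : DescriptorSystem n m p) (s : ℂ) : ℕ → Matrix (Fin n) (Fin (min m p)) ℂ
  | 0 => ((S.A - s • S.E)⁻¹)ᴴ * S.Cᴴ * S.PL s
  | r + 1 => ((S.A - s • S.E)⁻¹)ᴴ * S.Eᴴ * hatW S s r

/-- `Ṽ = [V̂₀ V̂₁ … V̂_q]`. -/
def tildeV (S : DescriptorSystem n m p) (q : ℕ) (s : ℂ) :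
    Matrix (Fin n) (Fin (q + 1) × Fin (min m p)) ℂ :=
  fun i rc => S.hatV s rc.1 i rc.2

/-- `W̃ = [Ŵ₀ Ŵ₁ … Ŵ_q]`. -/
def tildeW (S : DescriptorSystem n m p) (q : ℕ) (s : ℂ) :
    Matrix (Fin n) (Fin (q + 1) × Fin (min m p)) ℂ :=
  fun i rc => S.hatW s rc.1 i rc.2

/-- `V` is a possible value of `orth(M)`: its columns form an orthonormal basis of the column
space of `M`. -/
def IsOrth {k : ℕ} {ι : Type} [Fintype ι] (V : Matrix (Fin n) (Fin k) ℂ)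
    (M : Matrix (Fin n) ι ℂ) : Prop :=
  Vᴴ * V = 1 ∧ LinearMap.range V.mulVecLin = LinearMap.range M.mulVecLin

/-- The matrices `V ℓ`, `W ℓ` (with `k ℓ` orthonormal columns each) and the points `μ ℓ` are
produced by the subspace framework with one dominant pole sought and interpolation parameter `q`,
where the pole estimates `μ 1, …, μ N` have been computed, so that the termination test,
whichever it is, has failed at the iterations `1, …, N - 1` and the subspaces have been expanded
there. The initial subspaces are arbitrary; entries with larger index play no role. -/
structure IsRun (S : DescriptorSystem n m p) (q N : ℕ) (k : ℕ → ℕ)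
    (V W : (l : ℕ) → Matrix (Fin n) (Fin (k l)) ℂ) (μ : ℕ → ℂ) : Prop where
  initV : (V 0)ᴴ * V 0 = 1
  initW : (W 0)ᴴ * W 0 = 1
  estimate : ∀ l < N, (S.reduce (V l) (W l)).IsDominantPole (μ (l + 1))
  solvable : ∀ l, l + 1 < N → ¬ S.IsPole (μ (l + 1))
  expandV : ∀ l, l + 1 < N →
    IsOrth (V (l + 1)) (Matrix.fromCols (V l) (S.tildeV q (μ (l + 1))))
  expandW : ∀ l, l + 1 < N →
    IsOrth (W (l + 1)) (Matrix.fromCols (W l) (S.tildeW q (μ (l + 1))))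

end

end DescriptorSystem

section

open scoped Matrix.Norms.L2Operator

/-- The matrix 2-norm, i.e. the operator norm for the Euclidean norms. -/
noncomputable def specNorm {a b : ℕ} (M : Matrix (Fin a) (Fin b) ℂ) : ℝ := ‖M‖

end

/-- The Hessian of `g` at `s` with respect to `Re s` and `Im s`; the entry `(a, b)` is obtained by
differentiating first in the direction `b`, then in the direction `a`. -/
noncomputable def hessian (g : ℂ → ℝ) (s : ℂ) : Matrix (Fin 2) (Fin 2) ℝ :=
  Matrix.of fun a b =>
    lineDeriv ℝ (fun z => lineDeriv ℝ g z (![1, Complex.I] b)) s (![1, Complex.I] a)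

/-! Write `F = d_r N - d N_r`, where `d`, `N` are the determinant and numerator `C adj(sE - A) B` of
the full system and `d_r`, `N_r` those of the reduced one. Expansion at `μ` makes the two transfer
functions agree to first order there, so the entire function `F` has a double zero at `μ`
(`crossDiff_eq_of_right`, `crossDiff_eq_of_left`). Its coefficients are bounded uniformly over
orthonormal `V`, `W` (`crossDiff_bound`), so the maximum principle gives `|F(ν)| ≤ c |ν - μ|²`
(`norm_le_of_double_zero`). At a pole `ν` of the reduced system `d_r(ν) = 0`, which leaves `|d(ν)|
‖N_r(ν)‖ ≤ c |ν - μ|²`. The bound `β` controls `N_r(ν)` from below, and simplicity of the pole gives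
`|d(ν)| ≥ a |ν - λ₁|`. Hence `|ν - λ₁| = O(|ν - μ|²)`, and the part of the right-hand side due to
`ν` itself is absorbed for small `δ`. -/

namespace DescriptorSystem

variable {n m p k : ℕ}

/-! ### Hermite interpolation with denominators cleared. -/

section Interpolation

/-- Right residual: an approximate solution `X` of `(A - s E) X = B` gives the numerator of the
transfer function up to a multiple of the determinant. -/
lemma adjTransfer_eq_of_right (T : DescriptorSystem n m p) (s e : ℂ)
    (X Y : Matrix (Fin n) (Fin m) ℂ) (h : (T.A - s • T.E) * X = T.B - e • Y) :
    T.adjTransfer s = -((s • T.E - T.A).det • (T.C * X))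
      + e • (T.C * (s • T.E - T.A).adjugate * Y) := by
  have h1 : (s • T.E - T.A) * X = -T.B + e • Y := by
    rw [← neg_sub, Matrix.neg_mul, h]; abel
  have h2 : (s • T.E - T.A).det • X = (s • T.E - T.A).adjugate * (-T.B + e • Y) := by
    rw [← h1, ← Matrix.mul_assoc, Matrix.adjugate_mul, Matrix.smul_mul, Matrix.one_mul]
  have h3 : (s • T.E - T.A).det • (T.C * X)
      = T.C * ((s • T.E - T.A).adjugate * (-T.B + e • Y)) := by
    rw [← h2, Matrix.mul_smul]
  rw [h3, adjTransfer]
  simp only [Matrix.mul_add, Matrix.mul_neg, Matrix.mul_smul, Matrix.mul_assoc]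
  abel

/-- Left residual: an approximate solution `Z` of `Z (A - s E) = C` gives the numerator of the
transfer function up to a multiple of the determinant. -/
lemma adjTransfer_eq_of_left (T : DescriptorSystem n m p) (s e : ℂ)
    (Z Y : Matrix (Fin p) (Fin n) ℂ) (h : Z * (T.A - s • T.E) = T.C - e • Y) :
    T.adjTransfer s = -((s • T.E - T.A).det • (Z * T.B))
      + e • (Y * (s • T.E - T.A).adjugate * T.B) := by
  have h1 : Z * (s • T.E - T.A) = -T.C + e • Y := by
    rw [← neg_sub, Matrix.mul_neg, h]; abel
  have h2 : (s • T.E - T.A).det • Z = (-T.C + e • Y) * (s • T.E - T.A).adjugate := by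
    rw [← h1, Matrix.mul_assoc, Matrix.mul_adjugate, Matrix.mul_smul, Matrix.mul_one]
  have h3 : (s • T.E - T.A).det • (Z * T.B)
      = (-T.C + e • Y) * (s • T.E - T.A).adjugate * T.B := by
    rw [← h2, Matrix.smul_mul]
  rw [h3, adjTransfer]
  simp only [Matrix.add_mul, Matrix.neg_mul, Matrix.smul_mul]
  abel

/-- The difference of the transfer functions of the full and the reduced system, cleared of
denominators. -/
noncomputable def crossDiff (S : DescriptorSystem n m p) (V W : Matrix (Fin n) (Fin k) ℂ) (s : ℂ) :
    Matrix (Fin p) (Fin m) ℂ :=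
  (s • (S.reduce V W).E - (S.reduce V W).A).det • S.adjTransfer s
    - (s • S.E - S.A).det • (S.reduce V W).adjTransfer s

lemma differentiable_pencil_det {ι : Type*} [Fintype ι] [DecidableEq ι] (A E : Matrix ι ι ℂ) :
    Differentiable ℂ fun s : ℂ => (s • E - A).det := by
  simp only [Matrix.det_apply, Matrix.sub_apply, Matrix.smul_apply]
  fun_prop

lemma differentiable_pencil_adjugate {ι : Type*} [Fintype ι] [DecidableEq ι]
    (A E : Matrix ι ι ℂ) (i j : ι) :
    Differentiable ℂ fun s : ℂ => (s • E - A).adjugate i j := by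
  simp only [Matrix.adjugate_apply, Matrix.det_apply]
  refine Differentiable.fun_sum fun σ _ => Differentiable.const_smul ?_ _
  refine Differentiable.fun_finsetProd fun a _ => ?_
  by_cases h : σ a = j
  · simp [Matrix.updateRow_apply, h]
  · simp only [Matrix.updateRow_apply, h, if_false, Matrix.sub_apply, Matrix.smul_apply]
    fun_prop

lemma differentiable_mul_pencil_adjugate_mul {ι α γ : Type*} [Fintype ι] [DecidableEq ι]
    (A E : Matrix ι ι ℂ) (L : Matrix α ι ℂ) (R : Matrix ι γ ℂ) (a : α) (b : γ) :
    Differentiable ℂ fun s : ℂ => (L * (s • E - A).adjugate * R) a b := by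
  simp only [Matrix.mul_apply]
  have := differentiable_pencil_adjugate A E
  fun_prop

/-- Right Hermite interpolation of order one. -/
lemma crossDiff_eq_of_right (S : DescriptorSystem n m p) (V W : Matrix (Fin n) (Fin k) ℂ) (μ : ℂ)
    (Y₀ Y₁ : Matrix (Fin k) (Fin m) ℂ) (h₀ : (S.A - μ • S.E) * (V * Y₀) = S.B)
    (h₁ : (S.A - μ • S.E) * (V * Y₁) = S.E * (V * Y₀)) :
    ∃ R : ℂ → Matrix (Fin p) (Fin m) ℂ, (∀ a b, Differentiable ℂ fun s => R s a b) ∧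
      ∀ s, S.crossDiff V W s = (s - μ) ^ 2 • R s := by
  refine ⟨fun s => (s • (S.reduce V W).E - (S.reduce V W).A).det •
      (S.C * (s • S.E - S.A).adjugate * (S.E * (V * Y₁)))
    - (s • S.E - S.A).det • ((S.reduce V W).C *
      (s • (S.reduce V W).E - (S.reduce V W).A).adjugate * (Wᴴ * (S.E * (V * Y₁)))),
    fun a b => ?_, fun s => ?_⟩
  · simp only [Matrix.sub_apply, Matrix.smul_apply, smul_eq_mul]
    exact ((differentiable_pencil_det _ _).mul (differentiable_mul_pencil_adjugate_mul _ _ _ _ _ _)).sub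
      ((differentiable_pencil_det _ _).mul (differentiable_mul_pencil_adjugate_mul _ _ _ _ _ _))
  -- The Taylor series of `(A - sE)⁻¹ B` at `μ`, cut after the linear term, leaves a residual of
  -- order two.
  · have hs : (S.A - s • S.E) * (V * (Y₀ + (s - μ) • Y₁))
        = S.B - (s - μ) ^ 2 • (S.E * (V * Y₁)) := by
      have : S.A - s • S.E = (S.A - μ • S.E) - (s - μ) • S.E := by
        rw [sub_smul]; abel
      rw [this, Matrix.sub_mul, Matrix.mul_add, Matrix.mul_add, h₀, Matrix.mul_smul,
        Matrix.mul_smul, h₁, Matrix.smul_mul, Matrix.mul_add, Matrix.mul_smul, smul_add,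
        smul_smul, pow_two]
      abel
    -- The truncated series lies in the range of `V`, so applying `Wᴴ` gives the corresponding
    -- identity for the reduced system.
    have hr : ((S.reduce V W).A - s • (S.reduce V W).E) * (Y₀ + (s - μ) • Y₁)
        = (S.reduce V W).B - (s - μ) ^ 2 • (Wᴴ * (S.E * (V * Y₁))) := by
      have := congrArg (fun M => Wᴴ * M) hs
      simp only [Matrix.mul_sub, Matrix.mul_smul] at this
      simp only [reduce, ← this]
      simp only [Matrix.sub_mul, Matrix.mul_sub, Matrix.smul_mul, Matrix.mul_smul,
        Matrix.mul_assoc]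
    rw [crossDiff, adjTransfer_eq_of_right S s _ _ _ hs, adjTransfer_eq_of_right _ s _ _ _ hr]
    -- Both systems have the same approximate output, so the terms carrying both determinants cancel
    -- and only residuals remain.
    have hC : (S.reduce V W).C * (Y₀ + (s - μ) • Y₁) = S.C * (V * (Y₀ + (s - μ) • Y₁)) := by
      simp only [reduce, Matrix.mul_assoc]
    rw [hC]
    ext a b
    simp only [Matrix.sub_apply, Matrix.smul_apply, Matrix.add_apply, Matrix.neg_apply,
      smul_eq_mul]
    ring

/-- Left Hermite interpolation of order one. -/
lemma crossDiff_eq_of_left (S : DescriptorSystem n m p) (V W : Matrix (Fin n) (Fin k) ℂ) (μ : ℂ)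
    (Y₀ Y₁ : Matrix (Fin p) (Fin k) ℂ) (h₀ : (Y₀ * Wᴴ) * (S.A - μ • S.E) = S.C)
    (h₁ : (Y₁ * Wᴴ) * (S.A - μ • S.E) = (Y₀ * Wᴴ) * S.E) :
    ∃ R : ℂ → Matrix (Fin p) (Fin m) ℂ, (∀ a b, Differentiable ℂ fun s => R s a b) ∧
      ∀ s, S.crossDiff V W s = (s - μ) ^ 2 • R s := by
  refine ⟨fun s => (s • (S.reduce V W).E - (S.reduce V W).A).det •
      (((Y₁ * Wᴴ) * S.E) * (s • S.E - S.A).adjugate * S.B)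
    - (s • S.E - S.A).det • (((Y₁ * Wᴴ) * S.E * V) *
      (s • (S.reduce V W).E - (S.reduce V W).A).adjugate * (S.reduce V W).B),
    fun a b => ?_, fun s => ?_⟩
  · simp only [Matrix.sub_apply, Matrix.smul_apply, smul_eq_mul]
    exact ((differentiable_pencil_det _ _).mul (differentiable_mul_pencil_adjugate_mul _ _ _ _ _ _)).sub
      ((differentiable_pencil_det _ _).mul (differentiable_mul_pencil_adjugate_mul _ _ _ _ _ _))
  · have hs : ((Y₀ + (s - μ) • Y₁) * Wᴴ) * (S.A - s • S.E)
        = S.C - (s - μ) ^ 2 • ((Y₁ * Wᴴ) * S.E) := by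
      have : S.A - s • S.E = (S.A - μ • S.E) - (s - μ) • S.E := by
        rw [sub_smul]; abel
      rw [this, Matrix.mul_sub, Matrix.add_mul, Matrix.add_mul, h₀, Matrix.smul_mul,
        Matrix.smul_mul, h₁, Matrix.mul_smul, Matrix.add_mul, Matrix.smul_mul, smul_add,
        smul_smul, pow_two]
      abel
    have hr : (Y₀ + (s - μ) • Y₁) * ((S.reduce V W).A - s • (S.reduce V W).E)
        = (S.reduce V W).C - (s - μ) ^ 2 • ((Y₁ * Wᴴ) * S.E * V) := by
      have := congrArg (fun M => M * V) hs
      simp only [Matrix.sub_mul, Matrix.smul_mul] at this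
      simp only [reduce, ← this]
      simp only [Matrix.sub_mul, Matrix.mul_sub, Matrix.smul_mul, Matrix.mul_smul,
        Matrix.mul_assoc]
    rw [crossDiff, adjTransfer_eq_of_left S s _ _ _ hs, adjTransfer_eq_of_left _ s _ _ _ hr]
    have hB : (Y₀ + (s - μ) • Y₁) * (S.reduce V W).B = (Y₀ + (s - μ) • Y₁) * Wᴴ * S.B := by
      simp only [reduce, Matrix.mul_assoc]
    rw [hB]
    ext a b
    simp only [Matrix.sub_apply, Matrix.smul_apply, Matrix.add_apply, Matrix.neg_apply,
      smul_eq_mul]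
    ring

end Interpolation

/-! ### Taylor coefficients contained in the expanded subspaces. -/

section Expansion

lemma IsOrth.exists_mul_eq {ι κ τ : Type} [Fintype ι] [Fintype κ] {V : Matrix (Fin n) (Fin k) ℂ}
    {U : Matrix (Fin n) ι ℂ} {T : Matrix (Fin n) κ ℂ} (h : IsOrth V (Matrix.fromCols U T))
    (c : τ → κ) : ∃ Y : Matrix (Fin k) τ ℂ, V * Y = T.submatrix id c := by
  classical
  have key : ∀ t, ∃ y : Fin k → ℂ, V *ᵥ y = fun i => T i (c t) := by
    intro t
    have : (Matrix.fromCols U T) *ᵥ (Pi.single (Sum.inr (c t)) 1)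
        ∈ LinearMap.range (Matrix.fromCols U T).mulVecLin := ⟨_, rfl⟩
    rw [← h.2] at this
    obtain ⟨y, hy⟩ := this
    refine ⟨y, ?_⟩
    rw [Matrix.mulVecLin_apply] at hy
    rw [hy]
    ext i
    simp
  choose y hy using key
  refine ⟨Matrix.of fun i t => y t i, ?_⟩
  ext i t
  exact congrFun (hy t) i

lemma PR_submatrix (S : DescriptorSystem n m p) (s : ℂ) (h : m ≤ p) :
    (S.PR s).submatrix id (Fin.cast (min_eq_left h).symm) = 1 := by
  ext i j
  simp [PR, h, Matrix.one_apply, Fin.ext_iff]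

lemma PL_submatrix (S : DescriptorSystem n m p) (s : ℂ) (h : p ≤ m) :
    (S.PL s).submatrix id (Fin.cast (min_eq_right h).symm) = 1 := by
  ext i j
  simp [PL, h, Matrix.one_apply, Fin.ext_iff]

lemma submatrix_cols_mul {α β γ τ : Type*} [Fintype β] (M : Matrix α β ℂ) (N : Matrix β γ ℂ)
    (e : τ → γ) : (M * N).submatrix id e = M * N.submatrix id e := rfl

/-- For `m ≤ p` the factor `P_R` is the identity, so blocks 0 and 1 of `tildeV` are the full Taylor
coefficients of `(A - sE)⁻¹ B` at `μ`. -/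
lemma IsOrth.right_moments (S : DescriptorSystem n m p) (h : m ≤ p) {q : ℕ} (hq : 1 ≤ q) {μ : ℂ}
    (hμ : ¬ S.IsPole μ) {ι : Type} [Fintype ι] {U : Matrix (Fin n) ι ℂ}
    {V : Matrix (Fin n) (Fin k) ℂ} (hV : IsOrth V (Matrix.fromCols U (S.tildeV q μ))) :
    ∃ Y₀ Y₁ : Matrix (Fin k) (Fin m) ℂ, (S.A - μ • S.E) * (V * Y₀) = S.B ∧
      (S.A - μ • S.E) * (V * Y₁) = S.E * (V * Y₀) := by
  have hu : IsUnit (S.A - μ • S.E).det := isUnit_iff_ne_zero.2 hμ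
  let e : Fin m → Fin (min m p) := Fin.cast (min_eq_left h).symm
  obtain ⟨Y₀, hY₀⟩ := hV.exists_mul_eq (fun t : Fin m => ((0 : Fin (q + 1)), e t))
  obtain ⟨Y₁, hY₁⟩ := hV.exists_mul_eq (fun t : Fin m => ((⟨1, by omega⟩ : Fin (q + 1)), e t))
  have e₀ : V * Y₀ = (S.A - μ • S.E)⁻¹ * S.B := by
    rw [hY₀]
    change (S.hatV μ 0).submatrix id e = _
    rw [hatV, submatrix_cols_mul, PR_submatrix S μ h, Matrix.mul_one]
  have e₁ : V * Y₁ = (S.A - μ • S.E)⁻¹ * S.E * (V * Y₀) := by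
    rw [hY₁, hY₀]
    rfl
  refine ⟨Y₀, Y₁, ?_, ?_⟩
  · rw [e₀, Matrix.mul_nonsing_inv_cancel_left _ _ hu]
  · rw [e₁, Matrix.mul_assoc, Matrix.mul_nonsing_inv_cancel_left _ _ hu]

lemma IsOrth.left_moments (S : DescriptorSystem n m p) (h : p ≤ m) {q : ℕ} (hq : 1 ≤ q) {μ : ℂ}
    (hμ : ¬ S.IsPole μ) {ι : Type} [Fintype ι] {U : Matrix (Fin n) ι ℂ}
    {W : Matrix (Fin n) (Fin k) ℂ} (hW : IsOrth W (Matrix.fromCols U (S.tildeW q μ))) :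
    ∃ Y₀ Y₁ : Matrix (Fin p) (Fin k) ℂ, (Y₀ * Wᴴ) * (S.A - μ • S.E) = S.C ∧
      (Y₁ * Wᴴ) * (S.A - μ • S.E) = (Y₀ * Wᴴ) * S.E := by
  have hu : IsUnit (S.A - μ • S.E).det := isUnit_iff_ne_zero.2 hμ
  let e : Fin p → Fin (min m p) := Fin.cast (min_eq_right h).symm
  obtain ⟨Y₀, hY₀⟩ := hW.exists_mul_eq (fun t : Fin p => ((0 : Fin (q + 1)), e t))
  obtain ⟨Y₁, hY₁⟩ := hW.exists_mul_eq (fun t : Fin p => ((⟨1, by omega⟩ : Fin (q + 1)), e t))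
  have e₀ : W * Y₀ = ((S.A - μ • S.E)⁻¹)ᴴ * S.Cᴴ := by
    rw [hY₀]
    change (S.hatW μ 0).submatrix id e = _
    rw [hatW, submatrix_cols_mul, PL_submatrix S μ h, Matrix.mul_one]
  have e₁ : W * Y₁ = ((S.A - μ • S.E)⁻¹)ᴴ * S.Eᴴ * (W * Y₀) := by
    rw [hY₁, hY₀]
    rfl
  have f₀ : Y₀ᴴ * Wᴴ = S.C * (S.A - μ • S.E)⁻¹ := by
    rw [← Matrix.conjTranspose_mul, e₀]
    simp only [Matrix.conjTranspose_mul, Matrix.conjTranspose_conjTranspose]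
  have f₁ : Y₁ᴴ * Wᴴ = (Y₀ᴴ * Wᴴ) * S.E * (S.A - μ • S.E)⁻¹ := by
    rw [← Matrix.conjTranspose_mul, e₁]
    simp only [Matrix.conjTranspose_mul, Matrix.conjTranspose_conjTranspose, Matrix.mul_assoc]
  refine ⟨Y₀ᴴ, Y₁ᴴ, ?_, ?_⟩
  · rw [f₀, Matrix.nonsing_inv_mul_cancel_right _ _ hu]
  · rw [f₁, Matrix.nonsing_inv_mul_cancel_right _ _ hu]

end Expansion

/-! ### Bounds uniform over all orthonormal bases. -/

section Bounds

lemma norm_apply_le_one_of_orthonormal {V : Matrix (Fin n) (Fin k) ℂ} (h : Vᴴ * V = 1)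
    (i : Fin n) (j : Fin k) : ‖V i j‖ ≤ 1 := by
  have h1 := congrFun (congrFun h j) j
  simp only [Matrix.mul_apply, Matrix.conjTranspose_apply, Matrix.one_apply_eq] at h1
  have h2 : ∑ x, ‖V x j‖ ^ 2 = 1 := by
    have : ((∑ x, ‖V x j‖ ^ 2 : ℝ) : ℂ) = 1 := by
      rw [← h1]
      push_cast
      exact Finset.sum_congr rfl fun x _ => (Complex.conj_mul' (V x j)).symm
    exact_mod_cast this
  have h3 : ‖V i j‖ ^ 2 ≤ ∑ x, ‖V x j‖ ^ 2 :=
    Finset.single_le_sum (f := fun x => ‖V x j‖ ^ 2) (fun x _ => by positivity) (Finset.mem_univ i)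
  rw [h2] at h3
  exact (sq_le_one_iff₀ (norm_nonneg _)).1 h3

lemma card_le_of_orthonormal {V : Matrix (Fin n) (Fin k) ℂ} (h : Vᴴ * V = 1) : k ≤ n := by
  have h1 : (Vᴴ * V).rank ≤ V.rank := Matrix.rank_mul_le_right _ _
  rw [h, Matrix.rank_one, Fintype.card_fin] at h1
  exact h1.trans (by simpa using V.rank_le_height)

lemma norm_mul_apply_le {α β γ : Type*} [Fintype β] (M : Matrix α β ℂ) (N : Matrix β γ ℂ)
    {a b : ℝ} (ha : 0 ≤ a) (hM : ∀ i j, ‖M i j‖ ≤ a) (hN : ∀ i j, ‖N i j‖ ≤ b) (i : α) (j : γ) :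
    ‖(M * N) i j‖ ≤ Fintype.card β * (a * b) := by
  rw [Matrix.mul_apply]
  refine (norm_sum_le _ _).trans ?_
  calc ∑ x, ‖M i x * N x j‖ ≤ ∑ _x : β, a * b :=
        Finset.sum_le_sum fun x _ => by
          rw [norm_mul]
          exact mul_le_mul (hM i x) (hN x j) (norm_nonneg _) ha
    _ = _ := by simp

lemma norm_det_le {M : Matrix (Fin k) (Fin k) ℂ} {c : ℝ} (hM : ∀ i j, ‖M i j‖ ≤ c) :
    ‖M.det‖ ≤ k.factorial * c ^ k := by
  have := Matrix.det_le (A := M) (abv := NormedField.toAbsoluteValue ℂ) (x := c) hM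
  rw [Fintype.card_fin, nsmul_eq_mul] at this
  exact this

/-- An adjugate entry is the determinant of `M` with a row replaced by a unit vector; `1 ≤ c` covers
that row. -/
lemma norm_adjugate_apply_le {M : Matrix (Fin k) (Fin k) ℂ} {c : ℝ} (hc : 1 ≤ c)
    (hM : ∀ i j, ‖M i j‖ ≤ c) (i j : Fin k) : ‖M.adjugate i j‖ ≤ k.factorial * c ^ k := by
  rw [Matrix.adjugate_apply]
  refine norm_det_le fun a b => ?_
  rw [Matrix.updateRow_apply]
  split_ifs
  · rw [Pi.single_apply]
    split_ifs
    · simpa using hc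
    · simpa using zero_le_one.trans hc
  · exact hM a b

/-- Bounds, uniform over all orthonormal `V`, `W` (of any number of columns), for the determinant
and the numerator of the transfer function of the reduced system. -/
lemma reduce_bound (S : DescriptorSystem n m p) (r : ℝ) :
    ∃ c : ℝ, 0 ≤ c ∧ ∀ (k : ℕ) (V W : Matrix (Fin n) (Fin k) ℂ), Vᴴ * V = 1 → Wᴴ * W = 1 →
      ∀ s : ℂ, ‖s‖ ≤ r → ‖(s • (S.reduce V W).E - (S.reduce V W).A).det‖ ≤ c ∧
        ∀ a b, ‖(S.reduce V W).adjTransfer s a b‖ ≤ c := by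
  obtain ⟨x, hx⟩ : ∃ x : ℝ, ∀ s : ℂ, ‖s‖ ≤ r → ∀ i j, ‖(s • S.E - S.A) i j‖ ≤ x := by
    refine ⟨∑ i, ∑ j, (r * ‖S.E i j‖ + ‖S.A i j‖), fun s hs i j => ?_⟩
    have hr : 0 ≤ r := (norm_nonneg s).trans hs
    calc ‖(s • S.E - S.A) i j‖ ≤ ‖s * S.E i j‖ + ‖S.A i j‖ := norm_sub_le _ _
      _ ≤ r * ‖S.E i j‖ + ‖S.A i j‖ := by rw [norm_mul]; gcongr
      _ ≤ ∑ j, (r * ‖S.E i j‖ + ‖S.A i j‖) :=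
        Finset.single_le_sum (f := fun j => r * ‖S.E i j‖ + ‖S.A i j‖)
          (fun _ _ => by positivity) (Finset.mem_univ j)
      _ ≤ _ := Finset.single_le_sum (f := fun i => ∑ j, (r * ‖S.E i j‖ + ‖S.A i j‖))
          (fun _ _ => by positivity) (Finset.mem_univ i)
  obtain ⟨y, hy0, hyB, hyC⟩ : ∃ y : ℝ, 0 ≤ y ∧ (∀ i j, ‖S.B i j‖ ≤ y) ∧ ∀ i j, ‖S.C i j‖ ≤ y := by
    refine ⟨(∑ i, ∑ j, ‖S.B i j‖) + ∑ i, ∑ j, ‖S.C i j‖, by positivity, fun i j => ?_, fun i j => ?_⟩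
    · have h1 : ‖S.B i j‖ ≤ ∑ j, ‖S.B i j‖ :=
        Finset.single_le_sum (f := fun j => ‖S.B i j‖) (fun _ _ => by positivity)
          (Finset.mem_univ j)
      have h2 : ∑ j, ‖S.B i j‖ ≤ ∑ i, ∑ j, ‖S.B i j‖ :=
        Finset.single_le_sum (f := fun i => ∑ j, ‖S.B i j‖) (fun _ _ => by positivity)
          (Finset.mem_univ i)
      have h3 : 0 ≤ ∑ i, ∑ j, ‖S.C i j‖ := by positivity
      linarith
    · have h1 : ‖S.C i j‖ ≤ ∑ j, ‖S.C i j‖ :=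
        Finset.single_le_sum (f := fun j => ‖S.C i j‖) (fun _ _ => by positivity)
          (Finset.mem_univ j)
      have h2 : ∑ j, ‖S.C i j‖ ≤ ∑ i, ∑ j, ‖S.C i j‖ :=
        Finset.single_le_sum (f := fun i => ∑ j, ‖S.C i j‖) (fun _ _ => by positivity)
          (Finset.mem_univ i)
      have h3 : 0 ≤ ∑ i, ∑ j, ‖S.B i j‖ := by positivity
      linarith
  set x' : ℝ := max x 0
  have hx' : 0 ≤ x' := le_max_right _ _
  -- Taking `z ≥ 1` makes `z ^ k ≤ z ^ n`, which removes the dependence on the number of columns.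
  set z : ℝ := max 1 (n * (n * (1 * x') * 1))
  have hz : 1 ≤ z := le_max_left _ _
  set t : ℝ := n.factorial * z ^ n
  have ht : 0 ≤ t := by positivity
  set u : ℝ := n * (n * (n * (y * 1) * t) * (n * (1 * y)))
  refine ⟨max t u, ht.trans (le_max_left _ _), fun k V W hV hW s hs => ?_⟩
  have hk : k ≤ n := card_le_of_orthonormal hV
  have hk' : (k : ℝ) ≤ n := by exact_mod_cast hk
  have hV1 := norm_apply_le_one_of_orthonormal hV
  have hW1 : ∀ i j, ‖Wᴴ i j‖ ≤ 1 := fun i j => by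
    rw [Matrix.conjTranspose_apply, norm_star]
    exact norm_apply_le_one_of_orthonormal hW j i
  have hpencil : s • (S.reduce V W).E - (S.reduce V W).A = Wᴴ * (s • S.E - S.A) * V := by
    simp only [reduce, Matrix.mul_sub, Matrix.sub_mul, Matrix.mul_smul, Matrix.smul_mul]
  have hz' : ∀ i j, ‖(s • (S.reduce V W).E - (S.reduce V W).A) i j‖ ≤ z := fun i j => by
    rw [hpencil]
    have h1 := norm_mul_apply_le Wᴴ (s • S.E - S.A) zero_le_one hW1
      (fun i j => (hx s hs i j).trans (le_max_left x 0))
    have h2 := norm_mul_apply_le (Wᴴ * (s • S.E - S.A)) V (by positivity) h1 hV1 i j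
    rw [Fintype.card_fin] at h2
    exact h2.trans (le_max_right _ _)
  have hkt : k.factorial * z ^ k ≤ t := by
    have : (k.factorial : ℝ) ≤ n.factorial := by exact_mod_cast Nat.factorial_le hk
    have h2 : z ^ k ≤ z ^ n := pow_le_pow_right₀ hz hk
    exact mul_le_mul this h2 (by positivity) (by positivity)
  refine ⟨(norm_det_le hz').trans (hkt.trans (le_max_left _ _)), fun a b => ?_⟩
  have hadj := fun i j => (norm_adjugate_apply_le hz hz' i j).trans hkt
  have hCV := norm_mul_apply_le S.C V hy0 hyC hV1
  have hWB := norm_mul_apply_le Wᴴ S.B zero_le_one hW1 hyB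
  have h1 := norm_mul_apply_le _ _ (by positivity) hCV hadj
  have h2 := norm_mul_apply_le _ _ (by positivity) h1 hWB a b
  simp only [Fintype.card_fin] at h2
  refine h2.trans (le_trans ?_ (le_max_right _ _))
  show _ ≤ (n : ℝ) * (n * (n * (y * 1) * t) * (n * (1 * y)))
  gcongr

/-- Lets `reduce_bound` serve for the full system as well. -/
lemma reduce_one (S : DescriptorSystem n m p) : S.reduce 1 1 = S := by
  simp [reduce]

/-- Uniform bound for the cross difference on bounded sets. -/
lemma crossDiff_bound (S : DescriptorSystem n m p) (r : ℝ) :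
    ∃ c : ℝ, 0 ≤ c ∧ ∀ (k : ℕ) (V W : Matrix (Fin n) (Fin k) ℂ), Vᴴ * V = 1 → Wᴴ * W = 1 →
      ∀ s : ℂ, ‖s‖ ≤ r → ∀ a b, ‖S.crossDiff V W s a b‖ ≤ c := by
  obtain ⟨c, hc, h⟩ := S.reduce_bound r
  refine ⟨c * c + c * c, by positivity, fun k V W hV hW s hs a b => ?_⟩
  obtain ⟨h1, h2⟩ := h k V W hV hW s hs
  have h0 := h n 1 1 (by simp) (by simp) s hs
  rw [reduce_one] at h0
  simp only [crossDiff, Matrix.sub_apply, Matrix.smul_apply, smul_eq_mul]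
  refine (norm_sub_le _ _).trans ?_
  rw [norm_mul, norm_mul]
  exact add_le_add (mul_le_mul h1 (h0.2 a b) (norm_nonneg _) hc)
    (mul_le_mul h0.1 (h2 a b) (norm_nonneg _) hc)

end Bounds

/-! ### Maximum principle and growth of the determinant at a simple pole. -/

/-- A function with a double zero at `μ`, bounded by `c` on the unit circle about `μ`, is bounded
by `c |s - μ|²` inside. -/
lemma norm_le_of_double_zero {F R : ℂ → ℂ} {μ : ℂ} {c : ℝ} (hR : Differentiable ℂ R)
    (hF : ∀ s, F s = (s - μ) ^ 2 * R s) (hc : ∀ s, ‖s - μ‖ = 1 → ‖F s‖ ≤ c) {s : ℂ}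
    (hs : ‖s - μ‖ ≤ 1) : ‖F s‖ ≤ c * ‖s - μ‖ ^ 2 := by
  have hb : ∀ z ∈ frontier (Metric.ball μ 1), ‖R z‖ ≤ c := by
    intro z hz
    rw [frontier_ball μ one_ne_zero, mem_sphere_iff_norm] at hz
    have := hc z hz
    rwa [hF, norm_mul, norm_pow, hz, one_pow, one_mul] at this
  have hs' : s ∈ closure (Metric.ball μ 1) := by
    rwa [closure_ball μ one_ne_zero, mem_closedBall_iff_norm]
  have := Complex.norm_le_of_forall_mem_frontier_norm_le Metric.isBounded_ball
    hR.diffContOnCl hb hs'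
  rw [hF, norm_mul, norm_pow, mul_comm]
  gcongr

lemma IsEigenTriple.isPole {S : DescriptorSystem n m p} {l : ℂ} {v w : Fin n → ℂ}
    (h : S.IsEigenTriple l v w) : S.IsPole l := by
  refine Matrix.exists_mulVec_eq_zero_iff.1 ⟨v, ?_, h.1⟩
  rintro rfl
  simpa using h.2.2

lemma IsDominantPole.isPole {S : DescriptorSystem n m p} {l : ℂ} (h : S.IsDominantPole l) :
    S.IsPole l := by
  obtain ⟨v, w, hvw, -⟩ := h
  exact hvw.isPole

lemma IsPole.det_eq_zero {S : DescriptorSystem n m p} {l : ℂ} (h : S.IsPole l) :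
    (l • S.E - S.A).det = 0 := by
  rw [← neg_sub, Matrix.det_neg, show (S.A - l • S.E).det = 0 from h, mul_zero]

lemma eval_charPencil (S : DescriptorSystem n m p) (s : ℂ) :
    S.charPencil.eval s = (S.A - s • S.E).det := by
  rw [charPencil, ← Polynomial.coe_evalRingHom, RingHom.map_det]
  congr 1
  ext i j
  simp
  ring

/-- The determinant of the pencil grows at least linearly near a simple eigenvalue. -/
lemma IsSimplePole.exists_le_norm_det {S : DescriptorSystem n m p} {l : ℂ}
    (h : S.IsSimplePole l) : ∃ c > (0 : ℝ), ∃ δ > (0 : ℝ), ∀ s : ℂ, ‖s - l‖ ≤ δ →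
      c * ‖s - l‖ ≤ ‖(s • S.E - S.A).det‖ := by
  have h0 : S.charPencil ≠ 0 := by
    intro h0
    rw [IsSimplePole, h0, Polynomial.rootMultiplicity_zero] at h
    exact zero_ne_one h
  -- Multiplicity one gives `charPencil = (X - l) g` with `g(l) ≠ 0`, and `|g| > |g(l)| / 2` near
  -- `l`.
  obtain ⟨g, hg, hndvd⟩ := Polynomial.exists_eq_pow_rootMultiplicity_mul_and_not_dvd _ h0 l
  rw [show S.charPencil.rootMultiplicity l = 1 from h, pow_one] at hg
  have hgl : g.eval l ≠ 0 := fun hz => hndvd (Polynomial.dvd_iff_isRoot.2 hz)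
  have hpos : 0 < ‖g.eval l‖ := norm_pos_iff.2 hgl
  have hev : ∀ᶠ s in nhds l, ‖g.eval l‖ / 2 < ‖g.eval s‖ :=
    (g.continuous.norm.continuousAt (x := l)).eventually_const_lt (half_lt_self hpos)
  obtain ⟨ε, hε, hball⟩ := Metric.eventually_nhds_iff.1 hev
  refine ⟨‖g.eval l‖ / 2, half_pos hpos, ε / 2, half_pos hε, fun s hs => ?_⟩
  have h1 := hball (y := s) (by rw [dist_eq_norm]; linarith)
  have h2 : ‖(s • S.E - S.A).det‖ = ‖s - l‖ * ‖g.eval s‖ := by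
    rw [← neg_sub, Matrix.det_neg, norm_mul, norm_pow, norm_neg, norm_one, one_pow, one_mul,
      ← eval_charPencil, hg, Polynomial.eval_mul, norm_mul]
    simp
  rw [h2, mul_comm]
  gcongr

end DescriptorSystem

/-! ### Spectral norm estimates and one step of the framework. -/

open scoped Matrix.Norms.L2Operator in
/-- The spectral norm is bounded by a multiple of the largest entry. -/
lemma exists_specNorm_le (a b : ℕ) : ∃ c : ℝ, 0 ≤ c ∧ ∀ (M : Matrix (Fin a) (Fin b) ℂ) (x : ℝ),
    (∀ i j, ‖M i j‖ ≤ x) → specNorm M ≤ c * x := by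
  refine ⟨∑ i : Fin a, ∑ j : Fin b, ‖(Matrix.single i j 1 : Matrix (Fin a) (Fin b) ℂ)‖,
    by positivity, fun M x hM => ?_⟩
  rw [specNorm]
  conv_lhs => rw [Matrix.matrix_eq_sum_single M]
  refine (norm_sum_le _ _).trans ?_
  rw [Finset.sum_mul]
  refine Finset.sum_le_sum fun i _ => (norm_sum_le _ _).trans ?_
  rw [Finset.sum_mul]
  refine Finset.sum_le_sum fun j _ => ?_
  have : Matrix.single i j (M i j) = M i j • (Matrix.single i j 1 : Matrix (Fin a) (Fin b) ℂ) := by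
    rw [Matrix.smul_single, smul_eq_mul, mul_one]
  rw [this, norm_smul, mul_comm]
  gcongr
  exact hM i j

open scoped Matrix.Norms.L2Operator in
lemma specNorm_smul {a b : ℕ} (z : ℂ) (M : Matrix (Fin a) (Fin b) ℂ) :
    specNorm (z • M) = ‖z‖ * specNorm M := norm_smul z M

namespace DescriptorSystem

variable {n m p : ℕ}

/-- One step of the framework at `μ`: at a pole `ν` of the reduced system near `μ`, the
determinant of the full pencil is quadratically small in `|ν - μ|`. -/
lemma exists_det_mul_specNorm_le (S : DescriptorSystem n m p) (r : ℝ) :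
    ∃ c : ℝ, 0 ≤ c ∧ ∀ (q k k' : ℕ) (V W : Matrix (Fin n) (Fin k) ℂ)
      (V' W' : Matrix (Fin n) (Fin k') ℂ) (μ ν : ℂ), 1 ≤ q → ¬ S.IsPole μ →
      IsOrth V' (Matrix.fromCols V (S.tildeV q μ)) →
      IsOrth W' (Matrix.fromCols W (S.tildeW q μ)) →
      (S.reduce V' W').IsPole ν → ‖μ‖ ≤ r → ‖ν - μ‖ ≤ 1 →
      ‖(ν • S.E - S.A).det‖ * specNorm ((S.reduce V' W').adjTransfer ν) ≤ c * ‖ν - μ‖ ^ 2 := by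
  -- Radius `r + 1` contains the unit circle about `μ`.
  obtain ⟨c, hc, hF⟩ := S.crossDiff_bound (r + 1)
  obtain ⟨d, hd, hN⟩ := exists_specNorm_le p m
  refine ⟨d * c, by positivity, fun q k k' V W V' W' μ ν hq hμ hV hW hν hr hνμ => ?_⟩
  have key : ∃ R : ℂ → Matrix (Fin p) (Fin m) ℂ, (∀ a b, Differentiable ℂ fun s => R s a b) ∧
      ∀ s, S.crossDiff V' W' s = (s - μ) ^ 2 • R s := by
    -- Interpolation from one side suffices: the side with fewer ports, where `P_R` or `P_L` is the
    -- identity.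
    rcases le_total m p with h | h
    · obtain ⟨Y₀, Y₁, h₀, h₁⟩ := hV.right_moments S h hq hμ
      exact S.crossDiff_eq_of_right V' W' μ Y₀ Y₁ h₀ h₁
    · obtain ⟨Y₀, Y₁, h₀, h₁⟩ := hW.left_moments S h hq hμ
      exact S.crossDiff_eq_of_left V' W' μ Y₀ Y₁ h₀ h₁
  obtain ⟨R, hR, hFR⟩ := key
  rw [← specNorm_smul, mul_assoc]
  refine hN _ _ fun a b => ?_
  have h1 : ‖S.crossDiff V' W' ν a b‖ ≤ c * ‖ν - μ‖ ^ 2 := by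
    refine norm_le_of_double_zero (F := fun s => S.crossDiff V' W' s a b) (hR a b)
      (fun s => by simp [hFR s]) (fun s hs => ?_) hνμ
    refine hF k' V' W' hV.1 hW.1 s ?_ a b
    have := norm_add_le (s - μ) μ
    rw [sub_add_cancel, hs] at this
    linarith
  simpa [crossDiff, hν.det_eq_zero] using h1

end DescriptorSystem

/-! ### Quadratic convergence. -/

theorem theorem4p2 {n m p : ℕ} (S : DescriptorSystem n m p) (hS : S.Standing)
    (lam : ℂ) (hlam : S.IsDominantPole lam)
    (hadj : S.adjTransfer lam ≠ 0)
    (hhess : IsUnit (hessian S.f lam))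
    (β : ℝ) (hβ : 0 < β) :
    ∃ δ > (0 : ℝ), ∃ K > (0 : ℝ),
      ∀ (q : ℕ), (m = p → 1 ≤ q) → (m ≠ p → 2 ≤ q) →
      ∀ (k : ℕ → ℕ) (V W : (l : ℕ) → Matrix (Fin n) (Fin (k l)) ℂ) (μ : ℕ → ℂ) (j : ℕ),
        1 ≤ j → S.IsRun q (j + 1) k V W μ →
        ¬ S.IsPole (μ j) →
        ¬ (S.reduce (V j) (W j)).IsPole (μ j) →
        β ≤ specNorm ((S.reduce (V j) (W j)).adjTransfer (μ (j + 1))) →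
        ‖μ j - lam‖ ≤ δ → ‖μ (j + 1) - lam‖ ≤ δ →
        ‖lam - μ (j + 1)‖ ≤ K * ‖lam - μ j‖ ^ 2 := by
  obtain ⟨a, ha, δ₀, hδ₀, hdet⟩ := (hS.simple lam hlam.isPole).exists_le_norm_det
  obtain ⟨c, hc, hstep⟩ := S.exists_det_mul_specNorm_le (‖lam‖ + 1)
  set x : ℝ := (c + 1) / (a * β)
  have hx : 0 < x := by positivity
  -- `δ₀` validates the determinant bound, `1 / 2` gives `|ν - μ| ≤ 1`, and `1 / (4 * x)` allows the
  -- absorption in `h5`.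
  refine ⟨min δ₀ (min (1 / 2) (1 / (4 * x))), by positivity, 4 * x, by positivity, ?_⟩
  intro q hq1 hq2 k V W μ j hj hrun hμ _ hβN hδ1 hδ2
  obtain ⟨l, rfl⟩ : ∃ l, j = l + 1 := ⟨j - 1, by omega⟩
  have hq : 1 ≤ q := by
    by_cases h : m = p
    · exact hq1 h
    · exact one_le_two.trans (hq2 h)
  simp only [le_min_iff] at hδ1 hδ2
  obtain ⟨-, hδ1, -⟩ := hδ1
  obtain ⟨hδ2, hδ3, hδ4⟩ := hδ2
  generalize hν : μ (l + 1 + 1) = ν at *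
  have htri : ‖ν - μ (l + 1)‖ ≤ ‖ν - lam‖ + ‖μ (l + 1) - lam‖ := by
    have := norm_sub_le (ν - lam) (μ (l + 1) - lam)
    rwa [sub_sub_sub_cancel_right] at this
  have hμr : ‖μ (l + 1)‖ ≤ ‖lam‖ + 1 := by
    have := norm_add_le (μ (l + 1) - lam) lam
    rw [sub_add_cancel] at this
    linarith
  have h1 := hstep q _ _ _ _ _ _ (μ (l + 1)) ν hq hμ (hrun.expandV l (by omega))
    (hrun.expandW l (by omega)) (hν ▸ (hrun.estimate (l + 1) (by omega)).isPole) hμr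
    (by linarith)
  have h2 : a * ‖ν - lam‖ * β ≤ c * ‖ν - μ (l + 1)‖ ^ 2 :=
    (mul_le_mul (hdet ν hδ2) hβN hβ.le (norm_nonneg _)).trans h1
  rw [norm_sub_rev lam ν, norm_sub_rev lam (μ (l + 1))]
  set e := ‖ν - lam‖
  set g := ‖μ (l + 1) - lam‖
  have he : 0 ≤ e := norm_nonneg _
  have h3 : e ≤ x * (e + g) ^ 2 := by
    have h4 : c * ‖ν - μ (l + 1)‖ ^ 2 ≤ (c + 1) * (e + g) ^ 2 := by
      gcongr
      linarith
    rw [show x * (e + g) ^ 2 = (c + 1) * (e + g) ^ 2 / (a * β) by simp only [x]; ring,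
      le_div_iff₀ (by positivity)]
    linarith
  have h5 : x * e ^ 2 ≤ e / 4 := by
    have : e * (4 * x) ≤ 1 := (le_div_iff₀ (by positivity)).1 hδ4
    nlinarith
  -- From `(e + g)² ≤ 2e² + 2g²` and `h5`: `e ≤ e/2 + 2xg²`, hence `e ≤ 4xg²`.
  nlinarith [mul_nonneg hx.le (sq_nonneg (e - g))]
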